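/- **Conventions.** Let $k\ge 2$ and $n$ be integers with $k\le \frac{\log_2 n}{2}$. Put $N=\lfloor n/2^k\rfloor$, let $n_0$ be $N^{2/3}$ rounded down to an even integer, and let $m=n_0/2$. *Gadget.* Let $\mathbb F$ be a field with $2^N$ elements, identified with $\{0,1\}^N$ by an arbitrary bijection. Read a string $x_i\in\{0,1\}^n$ as a vector $(x_{i,1},\dots,x_{i,r})\in\mathbb F^r$ with $r=2^k$, the entries being the consecutive blocks of $N$ bits of $x_i$ (any remaining $n-2^kN<2^k$ bits are ignored). The gadget $g:(\{0,1\}^n)^{k-1}\to\{0,1\}^{n_0}$ maps $(x_2,\dots,x_k)$ to the first $n_0$ bits of the generalized inner product $\sum_{j=1}^{r}\prod_{i=2}^{k}x_{i,j}\in\mathbb F$. *Problem $\mathrm{HM}*g$.* The inputs are $x_1\in\{0,\dots,m-1\}$ and $x_2,\dots,x_k\in\{0,1\}^n$; player $i$ sees all of them except $x_i$. An answer $\langle \ell,r,b\rangle$ is valid if $(\ell,r)$ belongs to the perfect matching $M_{x_1}=\{(\ell,\,m+((x_1+\ell)\bmod m)):0\le \ell<m\}$ and $b=g(x_2,\dots,x_k)_\ell\oplus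 g(x_2,\dots,x_k)_r$ (coordinates are numbered $0,\dots,n_0-1$). *Protocols.* In a deterministic one-way number-on-the-forehead protocol $\Pi$ the players $1,\dots,k$ speak once each, in this order. Player $i$ sends a message of a fixed number $|\Pi_i|$ of bits that depends on the inputs it sees and on the earlier messages; afterwards player $k$ gives the answer, which depends on the inputs it sees and on all the messages. The error is the probability, for uniformly random $(x_1,\dots,x_k)$, that the answer is not valid. The *simplified version* $\Pi^*$ of $\Pi$ is the following protocol: player $1$ sends the same message as in $\Pi$; each player $i\ge 2$ sends the list of the $m$ messages that it would send in $\Pi$ for $x_1=0,1,\dots,m-1$, the $j$-th one being computed from the message of player $1$ and the $j$-th entries of the earlier lists; player $k$, who knows $x_1$, reads off the entry of index $x_1$ of each list and answers as in $\Pi$. So $|\Pi^*_1|=|\Pi_1|$ and $|\Pi^*_i|=m|\Pi_i|$ for $i\ge2$. A protocol is *simplified* if it is the simplified version of some protocol. **Theorem.** There is an absolute constant $c>0$ such that, for all $k$ and $n$ as above and every choice of the field and the bijection, every simplified protocol $\Pi^*$ for $\mathrm{HM}*g$ with error at most $1/16$ under the uniform distribution satisfies $$|\Pi^*_1|\ \ge\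 c\sqrt{n_0}\qquad\text{or}\qquad \sum_{i=2}^{k}|\Pi^*_i|\ \ge\ c\,\frac{n}{2^k}.$$ -/

import Mathlib

namespace NOF

/-- Bit strings of length `n`. -/
abbrev BitString (n : ℕ) : Type := Fin n → Bool

/-- A deterministic one-way number-on-the-forehead protocol with `k` players (`2 ≤ k`), with input
`x₁ : A` on the forehead of player `1` and inputs `x₂, …, x_k : Y` on the foreheads of players
`2, …, k`, and with answers in `Z`. The index `i : Fin (k - 1)` stands for player `i + 2`.

The players speak in the order `1, 2, …, k`, and each player sends one message of a fixed number of
bits which depends on the inputs that this player sees and on the messages sent earlier.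
After that, the last player (the one with `i + 2 = k`) gives the answer. -/
structure Protocol (k : ℕ) (A Y Z : Type) where
  /-- number of bits sent by player `1` -/
  len₁ : ℕ
  /-- number of bits sent by each of the players `2, …, k` -/
  len : Fin (k - 1) → ℕ
  /-- message of player `1`, who sees everything but `x₁` -/
  msg₁ : (Fin (k - 1) → Y) → BitString len₁
  /-- message of player `i + 2`, who sees `x₁` and all of `x₂, …, x_k` but its own input -/
  msg : (i : Fin (k - 1)) → A → ({j : Fin (k - 1) // j ≠ i} → Y) → BitString len₁ →
    ((j : Fin (k - 1)) → j < i → BitString (len j)) → BitString (len i)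
  /-- answer of player `k`, who sees everything but `x_k` -/
  out : A → ({j : Fin (k - 1) // (j : ℕ) + 2 ≠ k} → Y) → BitString len₁ →
    ((j : Fin (k - 1)) → BitString (len j)) → Z

namespace Protocol

variable {k : ℕ} {A Y Z : Type}

/-- The message that player `i + 2` sends when the protocol is run on `(x₁, x₂, …, x_k) = (a, y)`. -/
def sent (P : Protocol k A Y Z) (a : A) (y : Fin (k - 1) → Y) (i : Fin (k - 1)) :
    BitString (P.len i) :=
  P.msg i a (fun j => y j) (P.msg₁ y) (fun j _ => P.sent a y j)
termination_by i

/-- The answer of the protocol on the input `(x₁, x₂, …, x_k) = (a, y)`. -/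
def answer (P : Protocol k A Y Z) (a : A) (y : Fin (k - 1) → Y) : Z :=
  P.out a (fun j => y j) (P.msg₁ y) (P.sent a y)

open Classical in
/-- The probability, over a uniformly random input, that the answer of the protocol is not a
valid one for the search problem `R`. -/
noncomputable def error [Fintype A] [Fintype Y] (P : Protocol k A Y Z)
    (R : A → (Fin (k - 1) → Y) → Z → Prop) : ℝ :=
  ((Finset.univ.filter fun x : A × (Fin (k - 1) → Y) =>
      ¬ R x.1 x.2 (P.answer x.1 x.2)).card : ℝ) /
    (Fintype.card (A × (Fin (k - 1) → Y)) : ℝ)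

/-- The simplified version of a protocol: player `1` sends the same message as before, and each
player `i ≥ 2` ignores the actual value of `x₁` and sends the list of the `m` messages which it
would send for `x₁ = 0, …, m - 1`; the `j`-th of them is computed from the `j`-th entries of the
lists received before. The last player, who knows `x₁`, reads off the entries number `x₁` and
answers as before. -/
def simplify {m : ℕ} (P : Protocol k (Fin m) Y Z) : Protocol k (Fin m) Y Z where
  len₁ := P.len₁
  len i := m * P.len i
  msg₁ := P.msg₁
  msg i _ v w prev := fun b =>
    P.msg i (finProdFinEquiv.symm b).1 v w
      (fun l hl c => prev l hl (finProdFinEquiv ((finProdFinEquiv.symm b).1, c)))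
      (finProdFinEquiv.symm b).2
  out a v w t := P.out a v w (fun l c => t l (finProdFinEquiv (a, c)))

/-- A simplified protocol is the simplified version of some protocol. -/
def IsSimplified {m : ℕ} (Q : Protocol k (Fin m) Y Z) : Prop :=
  ∃ P : Protocol k (Fin m) Y Z, Q = P.simplify

end Protocol

/-- The perfect matching `M_i = {(ℓ, m + ((i + ℓ) mod m)) : 0 ≤ ℓ < m}` between
`{0, …, m - 1}` and `{m, …, 2m - 1}`. -/
def matching (m : ℕ) (i : Fin m) : Set (Fin (2 * m) × Fin (2 * m)) :=
  {e | ∃ l : Fin m, (e.1 : ℕ) = l ∧ (e.2 : ℕ) = m + ((i : ℕ) + l) % m}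

/-- The lifted hidden matching problem `HM * g`: the answer `⟨ℓ, r, b⟩` is valid for
`(x₁, x₂, …, x_k) = (a, y)` when `(ℓ, r) ∈ M_{x₁}` and `b = g(x₂, …, x_k)_ℓ ⊕ g(x₂, …, x_k)_r`. -/
def liftedHM {k n m : ℕ} (g : (Fin (k - 1) → BitString n) → BitString (2 * m))
    (a : Fin m) (y : Fin (k - 1) → BitString n) (z : Fin (2 * m) × Fin (2 * m) × Bool) : Prop :=
  (z.1, z.2.1) ∈ matching m a ∧ z.2.2 = xor (g y z.1) (g y z.2.1)

/-- The generalized inner product of `K` vectors in `F ^ r`. -/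
def GIP {K r : ℕ} {F : Type} [Field F] (x : Fin K → Fin r → F) : F :=
  ∑ j, ∏ i, x i j

/-- `N = n / 2 ^ k` (rounded down), the number of bits of an element of the field. -/
def fieldBits (k n : ℕ) : ℕ := n / 2 ^ k

/-- The number `m = n₀ / 2` of matchings, where `n₀` is `N ^ (2 / 3)` rounded down to an
even integer. -/
noncomputable def numMatchings (k n : ℕ) : ℕ := ⌊(fieldBits k n : ℝ) ^ (2 / 3 : ℝ) / 2⌋₊

/-- The output length `n₀ = 2 m` of the gadget. -/
noncomputable abbrev gadgetBits (k n : ℕ) : ℕ := 2 * numMatchings k n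

theorem gadgetBits_le (k n : ℕ) : gadgetBits k n ≤ fieldBits k n := by
  have h0 : (0 : ℝ) ≤ (fieldBits k n : ℝ) ^ (2 / 3 : ℝ) / 2 := by positivity
  have h1 : (numMatchings k n : ℝ) ≤ (fieldBits k n : ℝ) ^ (2 / 3 : ℝ) / 2 := Nat.floor_le h0
  have h2 : (fieldBits k n : ℝ) ^ (2 / 3 : ℝ) ≤ fieldBits k n := by
    rcases Nat.eq_zero_or_pos (fieldBits k n) with h | h
    · rw [h]
      norm_num
    · have h3 : (1 : ℝ) ≤ fieldBits k n := by exact_mod_cast h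
      calc (fieldBits k n : ℝ) ^ (2 / 3 : ℝ) ≤ (fieldBits k n : ℝ) ^ (1 : ℝ) :=
            Real.rpow_le_rpow_of_exponent_le h3 (by norm_num)
        _ = fieldBits k n := Real.rpow_one _
  have h4 : ((gadgetBits k n : ℕ) : ℝ) ≤ (fieldBits k n : ℕ) := by
    push_cast [gadgetBits]
    linarith
  exact_mod_cast h4

theorem block_index_lt {k n : ℕ} (j : Fin (2 ^ k)) (b : Fin (fieldBits k n)) :
    (j : ℕ) * fieldBits k n + b < n :=
  calc (j : ℕ) * fieldBits k n + b < (j : ℕ) * fieldBits k n + fieldBits k n :=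
        Nat.add_lt_add_left b.isLt _
    _ = ((j : ℕ) + 1) * fieldBits k n := by ring
    _ ≤ 2 ^ k * fieldBits k n := Nat.mul_le_mul_right _ j.isLt
    _ ≤ n := Nat.mul_div_le n (2 ^ k)

/-- The `j`-th block of `N` bits of a string of `n` bits. -/
def block {k n : ℕ} (x : BitString n) (j : Fin (2 ^ k)) : BitString (fieldBits k n) :=
  fun b => x ⟨(j : ℕ) * fieldBits k n + b, block_index_lt j b⟩

/-- The gadget `g : ({0,1}^n)^(k-1) → {0,1}^n₀`. Let `F` be a field whose elements are identified
with the bit strings of length `N` by `e`. Each `x_i` is read as a vector of `r = 2 ^ k`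
elements of `F`, and the gadget returns the first `n₀` bits of the generalized inner product
of `x₂, …, x_k`. -/
noncomputable def gadget {k n : ℕ} {F : Type} [Field F] (e : F ≃ BitString (fieldBits k n))
    (y : Fin (k - 1) → BitString n) : BitString (gadgetBits k n) :=
  fun b => e (GIP fun (i : Fin (k - 1)) (j : Fin (2 ^ k)) => e.symm (block (y i) j))
    (Fin.castLE (gadgetBits_le k n) b)

end NOF

namespace NOF

open Finset BigOperators

/-! Fix a message `w` of player 1 and let the players 2, ..., k run as if `w` had been sent. Their
messages for all values of x₁, together with the answers for all values of x₁, form the view. That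
the view equals a given `v` splits into one condition per player, none of which involves the input
on that player's own forehead (`Protocol.view_eq_iff`, `Protocol.consistent_update`); so the event
is a cylinder intersection. By the Babai–Nisan–Szegedy argument (`norm_expect_addChar_cylinder_le`)
and Fourier inversion (`norm_expect_gip_eq_sub_le`), the generalized inner product is nearly uniform
on it: each field element has its expected mass up to ε = ((k-2)/2^N)^4. There are 2^C (8m²)^m
views, where C is the simplified cost of the players 2, ..., k. As n₀ ≤ N^(2/3), replacing the
gadget's output by a uniform string independent of the view costs in total at most 2^C / 2^N
(`answers_mul_discrepancy_le`).

Against an independent uniform string the m answers are a fixed list. The matchings are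
edge-disjoint, so the number of correct answers is controlled by a bilinear form in random signs
with at most m nonzero coefficients, all ±1. Its exponential moment shows that three quarters of the
answers are correct with probability at most 2 exp(-√m/3); Markov's inequality gives 2/3 for every
m.

Error 1/16 forces three quarters of the answers to be correct with probability at least 3/4. A union
bound over the 2^L messages of player 1 bounds this probability by 2^L (δ + 2^C / 2^N), with δ the
smaller of the two bounds above; this is less than 3/4 when L and C are both small. -/

/-- The map `φ` sends the uniform distribution on `V` to the uniform distribution on `W`. -/
def Equidistributed {V W : Type*} [Fintype V] [Fintype W] (φ : V → W) : Prop :=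
  ∀ G : W → ℂ, 𝔼 v, G (φ v) = 𝔼 w, G w

theorem Equidistributed.expect_real {V W : Type*} [Fintype V] [Fintype W] {φ : V → W}
    (hφ : Equidistributed φ) (G : W → ℝ) : 𝔼 v, G (φ v) = 𝔼 w, G w := by
  have h := hφ fun w => (G w : ℂ)
  have h1 : ((𝔼 v, G (φ v) : ℝ) : ℂ) = ((𝔼 w, G w : ℝ) : ℂ) := by
    rw [Complex.ofReal_expect, Complex.ofReal_expect]
    exact h
  exact_mod_cast h1

/-! ### Moments and factorization of uniform averages -/

theorem sq_expect_le {α : Type*} [Fintype α] [Nonempty α] (f : α → ℝ) :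
    (𝔼 x, f x) ^ 2 ≤ 𝔼 x, f x ^ 2 := by
  have h := Finset.expect_mul_sq_le_sq_mul_sq Finset.univ f fun _ => 1
  simpa using h

theorem expect_pow_two_pow_le {α : Type*} [Fintype α] [Nonempty α] (K : ℕ) :
    ∀ f : α → ℝ, (∀ x, 0 ≤ f x) → (𝔼 x, f x) ^ 2 ^ K ≤ 𝔼 x, f x ^ 2 ^ K := by
  induction K with
  | zero => intro f _; simp
  | succ K ih =>
    intro f hf
    calc (𝔼 x, f x) ^ 2 ^ (K + 1) = ((𝔼 x, f x) ^ 2) ^ 2 ^ K := by rw [← pow_mul, pow_succ']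
      _ ≤ (𝔼 x, f x ^ 2) ^ 2 ^ K := pow_le_pow_left₀ (sq_nonneg _) (sq_expect_le f) _
      _ ≤ 𝔼 x, (f x ^ 2) ^ 2 ^ K := ih _ fun x => sq_nonneg _
      _ = 𝔼 x, f x ^ 2 ^ (K + 1) := by simp_rw [← pow_mul, ← pow_succ']

theorem expect_prod_apply {ι F R : Type*} [Fintype ι] [DecidableEq ι] [Fintype F] [Field R]
    [CharZero R] (h : ι → F → R) : 𝔼 u : ι → F, ∏ j, h j (u j) = ∏ j, 𝔼 t, h j t := by
  simp_rw [Fintype.expect_eq_sum_div_card]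
  rw [Finset.prod_div_distrib, Finset.prod_univ_sum, Fintype.piFinset_univ]
  simp

theorem expect_fin_succ {V M : Type*} [Fintype V] [AddCommMonoid M] [Module ℚ≥0 M] {K : ℕ}
    (f : (Fin (K + 1) → V) → M) :
    𝔼 x, f x = 𝔼 x : Fin K → V, 𝔼 v, f (Fin.cons v x) := by
  rw [Finset.expect_comm, ← Finset.expect_product' Finset.univ Finset.univ
    fun v (x : Fin K → V) => f (Fin.cons v x : Fin (K + 1) → V), Finset.univ_product_univ]
  exact (Fintype.expect_equiv (Fin.consEquiv fun _ => V) _ _ fun _ => rfl).symm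

/-! ### Discrepancy of the generalized inner product -/

section Discrepancy

variable {ι F V : Type*} [Fintype ι] [DecidableEq ι] [Field F] [Fintype F] [DecidableEq F]
  [Fintype V]

/-- Bound for the contribution of a coordinate with weight `a` after `K` steps. -/
noncomputable def coordBound (F : Type*) [Field F] [Fintype F] [DecidableEq F] (K : ℕ) (a : F) :
    ℝ :=
  if a = 0 then 1 else K / Fintype.card F

theorem coordBound_nonneg (K : ℕ) (a : F) : 0 ≤ coordBound F K a := by
  unfold coordBound
  split_ifs <;> positivity

/-- Union bound: the new factor `t` vanishes with probability 1/q, and otherwise the weight stays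
nonzero and the earlier bound K/q applies. Thus `coordBound` dominates the probability that `a`
times K uniform field elements is zero. -/
theorem expect_coordBound_mul_le (K : ℕ) (a : F) :
    𝔼 t, coordBound F K (a * t) ≤ coordBound F (K + 1) a := by
  have hq : (0 : ℝ) < Fintype.card F := by exact_mod_cast Fintype.card_pos
  by_cases ha : a = 0
  · simp [coordBound, ha]
  · calc 𝔼 t, coordBound F K (a * t)
        ≤ 𝔼 t : F, ((if t = 0 then (1 : ℝ) else 0) + K / Fintype.card F) := by
          refine Finset.expect_le_expect fun t _ => ?_
          unfold coordBound
          by_cases ht : t = 0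
          · simp only [ht, mul_zero, if_true]
            have : (0 : ℝ) ≤ K / Fintype.card F := by positivity
            linarith
          · simp [ha, ht]
      _ = coordBound F (K + 1) a := by
          rw [Finset.expect_add_distrib, Fintype.expect_const, Fintype.expect_eq_sum_div_card]
          simp [coordBound, ha]
          ring

theorem expect_addChar_mul {ψ : AddChar F ℂ} (hψ : ψ.IsPrimitive) (a : F) :
    𝔼 t, ψ (a * t) = if a = 0 then 1 else 0 := by
  rw [Fintype.expect_eq_sum_div_card]
  have h := AddChar.sum_mulShift a hψ
  simp_rw [mul_comm a]
  rw [h]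
  have hq : (Fintype.card F : ℂ) ≠ 0 := by exact_mod_cast Fintype.card_ne_zero
  split_ifs <;> simp [hq]

omit [DecidableEq ι] [Fintype F] [DecidableEq F] in
theorem addChar_map_sum (ψ : AddChar F ℂ) (f : ι → F) : ψ (∑ j, f j) = ∏ j, ψ (f j) := by
  have h := map_prod ψ.toMonoidHom (fun j => Multiplicative.ofAdd (f j)) Finset.univ
  rw [← ofAdd_sum] at h
  exact h

theorem norm_expect_addChar_linear {ψ : AddChar F ℂ} (hψ : ψ.IsPrimitive) {φ : V → ι → F}
    (hφ : Equidistributed φ) (a : ι → F) :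
    ‖𝔼 v, ψ (∑ j, a j * φ v j)‖ ≤ ∏ j, coordBound F 0 (a j) := by
  rw [hφ fun u => ψ (∑ j, a j * u j)]
  simp_rw [addChar_map_sum]
  rw [expect_prod_apply fun j t => ψ (a j * t), norm_prod]
  refine le_of_eq (Finset.prod_congr rfl fun j _ => ?_)
  rw [expect_addChar_mul hψ, coordBound]
  split_ifs <;> simp

omit [DecidableEq F] in
-- For each fixed second sample, subtracting it is a translation and preserves the uniform
-- distribution.
theorem Equidistributed.expect_sub [Nonempty V] {φ : V → ι → F} (hφ : Equidistributed φ)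
    (G : (ι → F) → ℝ) : 𝔼 p : V × V, G (φ p.1 - φ p.2) = 𝔼 u, G u := by
  rw [← Finset.univ_product_univ, Finset.expect_product, Finset.expect_comm]
  have h : ∀ v' : V, 𝔼 v, G (φ v - φ v') = 𝔼 u, G u := fun v' => by
    rw [hφ.expect_real fun u => G (u - φ v')]
    exact Fintype.expect_equiv (Equiv.subRight (φ v')) _ _ fun _ => rfl
  simp_rw [h]
  exact Fintype.expect_const _

omit [DecidableEq F] in
theorem star_addChar (ψ : AddChar F ℂ) (x : F) : starRingEnd ℂ (ψ x) = ψ (-x) :=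
  (AddChar.map_neg_eq_conj ψ x).symm

theorem norm_expect_sq_eq {α : Type*} [Fintype α] (h : α → ℂ) :
    ((‖𝔼 v, h v‖ ^ 2 : ℝ) : ℂ) = 𝔼 p : α × α, h p.1 * starRingEnd ℂ (h p.2) := by
  rw [← Finset.univ_product_univ, Finset.expect_product]
  simp_rw [← Finset.mul_expect]
  rw [← Finset.expect_mul, Complex.ofReal_pow, ← Complex.mul_conj']
  congr 1
  simp_rw [Fintype.expect_eq_sum_div_card]
  simp

/-- The Babai–Nisan–Szegedy bound for the correlation of a character of the (weighted) generalized
inner product with a cylinder intersection. -/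
theorem norm_expect_addChar_cylinder_le [Nonempty V] {ψ : AddChar F ℂ} (hψ : ψ.IsPrimitive)
    {φ : V → ι → F} (hφ : Equidistributed φ) (K : ℕ) :
    ∀ (a : ι → F) (c : Fin (K + 1) → (Fin (K + 1) → V) → ℂ),
      (∀ i x, ‖c i x‖ ≤ 1) → (∀ i x v, c i (Function.update x i v) = c i x) →
      ‖𝔼 x : Fin (K + 1) → V, ψ (∑ j, a j * ∏ i, φ (x i) j) * ∏ i, c i x‖ ^ 2 ^ K ≤
        ∏ j, coordBound F K (a j) := by
  induction K with
  | zero =>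
    intro a c hc hind
    obtain ⟨v₀⟩ := ‹Nonempty V›
    have h0 : ∀ (v : V) (x : Fin 0 → V), c 0 (Fin.cons v x) = c 0 (Fin.cons v₀ x) := fun v x => by
      simpa only [Fin.update_cons_zero] using hind 0 (Fin.cons v₀ x) v
    rw [expect_fin_succ]
    simp only [Fin.prod_univ_succ, Fin.cons_zero, Finset.univ_eq_empty, Finset.prod_empty, mul_one,
      pow_zero, pow_one, h0, ← Finset.expect_mul]
    refine (RCLike.norm_expect_le (K := ℂ)).trans
      (Finset.expect_le Finset.univ_nonempty fun x _ => ?_)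
    rw [norm_mul]
    exact (mul_le_of_le_one_right (norm_nonneg _) (hc _ _)).trans
      (norm_expect_addChar_linear hψ hφ a)
  | succ K ih =>
    intro a c hc hind
    have v₀ : V := Classical.arbitrary V
    have h0 : ∀ (v : V) (x : Fin (K + 1) → V), c 0 (Fin.cons v x) = c 0 (Fin.cons v₀ x) :=
      fun v x => by
        simpa only [Fin.update_cons_zero] using hind 0 (Fin.cons v₀ x) v
    -- Cauchy–Schwarz step: `c 0` does not depend on the first input, so it leaves the inner average
    -- and is bounded by 1. Squaring the rest doubles the first input to a pair, which enters the
    -- character only through the new weights `a j * (φ p.1 - φ p.2) j`; the remaining factors still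
    -- form a cylinder product in one variable fewer.
    set h : (Fin (K + 1) → V) → V → ℂ := fun x v =>
      ψ (∑ j, a j * (φ v j * ∏ i, φ (x i) j)) * ∏ i : Fin (K + 1), c i.succ (Fin.cons v x) with hh
    set g : V × V → ℂ := fun p => 𝔼 x : Fin (K + 1) → V,
      ψ (∑ j, (a j * (φ p.1 - φ p.2) j) * ∏ i, φ (x i) j) *
        ∏ i : Fin (K + 1), (c i.succ (Fin.cons p.1 x) * starRingEnd ℂ (c i.succ (Fin.cons p.2 x)))
      with hg
    have hg1 : ∀ p, ‖g p‖ ^ 2 ^ K ≤ ∏ j, coordBound F K (a j * (φ p.1 - φ p.2) j) := fun p => by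
      refine ih (fun j => a j * (φ p.1 - φ p.2) j) (fun i x =>
        c i.succ (Fin.cons p.1 x) * starRingEnd ℂ (c i.succ (Fin.cons p.2 x))) ?_ ?_
      · intro i x
        rw [norm_mul, RCLike.norm_conj]
        exact mul_le_one₀ (hc _ _) (norm_nonneg _) (hc _ _)
      · intro i x v
        simp only [Fin.cons_update, hind]
    have hE : 𝔼 x : Fin (K + 2) → V, ψ (∑ j, a j * ∏ i, φ (x i) j) * ∏ i, c i x =
        𝔼 x : Fin (K + 1) → V, c 0 (Fin.cons v₀ x) * 𝔼 v, h x v := by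
      rw [expect_fin_succ]
      refine Finset.expect_congr rfl fun x _ => ?_
      rw [Finset.mul_expect]
      refine Finset.expect_congr rfl fun v _ => ?_
      simp only [hh, Fin.prod_univ_succ, Fin.cons_zero, Fin.cons_succ, h0]
      ring
    have hsq : ‖𝔼 x : Fin (K + 2) → V, ψ (∑ j, a j * ∏ i, φ (x i) j) * ∏ i, c i x‖ ^ 2 ≤
        𝔼 p, ‖g p‖ := by
      rw [hE]
      calc _ ≤ (𝔼 x : Fin (K + 1) → V, ‖𝔼 v, h x v‖) ^ 2 := by
            refine pow_le_pow_left₀ (norm_nonneg _) ?_ 2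
            refine (RCLike.norm_expect_le (K := ℂ)).trans (Finset.expect_le_expect fun x _ => ?_)
            rw [norm_mul]
            exact mul_le_of_le_one_left (norm_nonneg _) (hc _ _)
        _ ≤ 𝔼 x : Fin (K + 1) → V, ‖𝔼 v, h x v‖ ^ 2 := sq_expect_le _
        _ = ‖𝔼 p, g p‖ := by
            have h1 : (((𝔼 x : Fin (K + 1) → V, ‖𝔼 v, h x v‖ ^ 2 : ℝ)) : ℂ) = 𝔼 p, g p := by
              rw [Complex.ofReal_expect]
              simp_rw [norm_expect_sq_eq]
              rw [Finset.expect_comm]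
              refine Finset.expect_congr rfl fun p _ => Finset.expect_congr rfl fun x _ => ?_
              simp only [hh, map_mul, map_prod, star_addChar]
              rw [mul_mul_mul_comm, ← AddChar.map_add_eq_mul, ← Finset.prod_mul_distrib,
                ← Finset.sum_neg_distrib, ← Finset.sum_add_distrib]
              congr 2
              refine Finset.sum_congr rfl fun j _ => ?_
              simp only [Pi.sub_apply]
              ring
            rw [← h1, Complex.norm_real, Real.norm_of_nonneg]
            exact Finset.expect_nonneg fun x _ => sq_nonneg _
        _ ≤ 𝔼 p, ‖g p‖ := RCLike.norm_expect_le (K := ℂ)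
    rw [pow_succ', pow_mul]
    calc _ ≤ (𝔼 p, ‖g p‖) ^ 2 ^ K := pow_le_pow_left₀ (sq_nonneg _) hsq _
      _ ≤ 𝔼 p, ‖g p‖ ^ 2 ^ K := expect_pow_two_pow_le K _ fun _ => norm_nonneg _
      _ ≤ 𝔼 p : V × V, ∏ j, coordBound F K (a j * (φ p.1 - φ p.2) j) :=
          Finset.expect_le_expect fun p _ => hg1 p
      _ = 𝔼 u : ι → F, ∏ j, coordBound F K (a j * u j) :=
          hφ.expect_sub fun u => ∏ j, coordBound F K (a j * u j)
      _ = ∏ j, 𝔼 t, coordBound F K (a j * t) :=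
          expect_prod_apply fun j t => coordBound F K (a j * t)
      _ ≤ ∏ j, coordBound F (K + 1) (a j) :=
          Finset.prod_le_prod (fun j _ => Finset.expect_nonneg fun t _ => coordBound_nonneg _ _)
            fun j _ => expect_coordBound_mul_le K (a j)

theorem exists_isPrimitive_addChar (F : Type*) [Field F] [Fintype F] :
    ∃ ψ : AddChar F ℂ, ψ.IsPrimitive := by
  obtain ⟨ψ, hψ⟩ := AddChar.exists_apply_ne_zero.2 (one_ne_zero : (1 : F) ≠ 0)
  exact ⟨ψ, AddChar.IsPrimitive.of_ne_one fun h => hψ (by simp [h])⟩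

/-- The value of the generalized inner product is nearly uniform on every cylinder intersection. -/
theorem norm_expect_gip_eq_sub_le [Nonempty V] {φ : V → ι → F} (hφ : Equidistributed φ) (K : ℕ)
    (c : Fin (K + 1) → (Fin (K + 1) → V) → ℂ) (hc : ∀ i x, ‖c i x‖ ≤ 1)
    (hind : ∀ i x v, c i (Function.update x i v) = c i x) {ε : ℝ} (hε : 0 ≤ ε)
    (hKε : ((K : ℝ) / Fintype.card F) ^ Fintype.card ι ≤ ε ^ 2 ^ K) (u : F) :
    ‖𝔼 x : Fin (K + 1) → V, (if ∑ j, ∏ i, φ (x i) j = u then 1 else 0) * ∏ i, c i x -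
      (𝔼 x : Fin (K + 1) → V, ∏ i, c i x) / Fintype.card F‖ ≤ ε := by
  obtain ⟨ψ, hψ⟩ := exists_isPrimitive_addChar F
  set S : (Fin (K + 1) → V) → F := fun x => ∑ j, ∏ i, φ (x i) j with hS
  set D : F → ℂ := fun b => 𝔼 x, ψ (b * S x) * ∏ i, c i x with hD
  have hq : (0 : ℝ) < Fintype.card F := by exact_mod_cast Fintype.card_pos
  have hbound : ∀ b, b ≠ 0 → ‖D b‖ ≤ ε := fun b hb => by
    have h := norm_expect_addChar_cylinder_le hψ hφ K (fun _ => b) c hc hind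
    simp only [coordBound, hb, if_false, Finset.prod_const, Finset.card_univ,
      ← Finset.mul_sum] at h
    exact (pow_le_pow_iff_left₀ (norm_nonneg _) hε (by positivity)).1 (h.trans hKε)
  -- Fourier expansion of the indicator of `S x = u`. The zero frequency is the main term; each of
  -- the others contributes at most ε, and the normalization 1/q compensates for their number.
  have hexp : 𝔼 x, (if S x = u then 1 else 0) * ∏ i, c i x = 𝔼 b, ψ (-(b * u)) * D b := by
    simp only [hD, Finset.mul_expect]
    rw [Finset.expect_comm]
    refine Finset.expect_congr rfl fun x _ => ?_
    have h := expect_addChar_mul hψ (S x - u)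
    simp only [sub_eq_zero] at h
    rw [← h, Finset.expect_mul]
    refine Finset.expect_congr rfl fun b _ => ?_
    rw [← mul_assoc, ← AddChar.map_add_eq_mul]
    congr 2
    ring
  have hD0 : D 0 = 𝔼 x, ∏ i, c i x := by simp [hD]
  rw [hexp, ← hD0, Fintype.expect_eq_sum_div_card, ← Finset.add_sum_erase _ _ (Finset.mem_univ 0),
    ← sub_div, zero_mul, neg_zero, AddChar.map_zero_eq_one, one_mul, add_sub_cancel_left, norm_div,
    Complex.norm_natCast, div_le_iff₀ hq]
  calc _ ≤ ∑ b ∈ Finset.univ.erase (0 : F), ‖ψ (-(b * u)) * D b‖ := norm_sum_le _ _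
    _ ≤ ∑ b ∈ Finset.univ.erase (0 : F), ε := Finset.sum_le_sum fun b hb => by
        rw [norm_mul, AddChar.norm_apply, one_mul]
        exact hbound b (Finset.ne_of_mem_erase hb)
    _ ≤ ∑ b : F, ε := Finset.sum_le_sum_of_subset_of_nonneg (Finset.erase_subset _ _)
        fun _ _ _ => hε
    _ = ε * Fintype.card F := by rw [Finset.sum_const, Finset.card_univ, nsmul_eq_mul, mul_comm]

end Discrepancy

/-! ### Maps preserving the uniform distribution -/

section Equidistribution

variable {V W X : Type*} [Fintype V] [Fintype W] [Fintype X]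

theorem Equidistributed.comp {χ : W → X} {φ : V → W} (hχ : Equidistributed χ)
    (hφ : Equidistributed φ) : Equidistributed fun v => χ (φ v) := fun G =>
  (hφ fun w => G (χ w)).trans (hχ G)

theorem Equidistributed.of_equiv (e : V ≃ W) : Equidistributed e := fun _ =>
  Fintype.expect_equiv e _ _ fun _ => rfl

theorem Equidistributed.fst [Nonempty W] : Equidistributed (Prod.fst : V × W → V) := fun G => by
  rw [← Finset.univ_product_univ, Finset.expect_product]
  exact Finset.expect_congr rfl fun v _ => Fintype.expect_const (G v)

/-- Restricting a uniformly random function along an injection gives a uniformly random function. -/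
theorem Equidistributed.comp_injective {α β γ : Type*} [Fintype α] [Fintype β] [DecidableEq α]
    [DecidableEq β] [Fintype γ] [Nonempty γ] {ι : α → β} (hι : Function.Injective ι) :
    Equidistributed fun (x : β → γ) (a : α) => x (ι a) := by
  classical
  have h1 := Equidistributed.of_equiv
    (Equiv.piEquivPiSubtypeProd (fun b => b ∈ Set.range ι) fun _ => γ)
  have h2 := Equidistributed.of_equiv
    (Equiv.arrowCongr (Equiv.ofInjective ι hι).symm (Equiv.refl γ))
  have h3 := h2.comp ((Equidistributed.fst (V := Set.range ι → γ)
    (W := {b // b ∉ Set.range ι} → γ)).comp h1)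
  exact h3

end Equidistribution

/-! ### Exponential moments of forms in random signs -/

/-- The sign `±1` of a bit. -/
def sign (b : Bool) : ℝ := if b then -1 else 1

theorem sign_xor (a b : Bool) : sign (xor a b) = sign a * sign b := by
  cases a <;> cases b <;> simp [sign]

theorem sign_mul_self (a : Bool) : sign a * sign a = 1 := by
  cases a <;> simp [sign]

theorem sign_not (a : Bool) : sign (!a) = -sign a := by
  cases a <;> simp [sign]

/-- The signs are independent, and each factor averages to cosh w ≤ exp(w²/2). -/
theorem expect_exp_sign_sum_le {β : Type*} [Fintype β] [DecidableEq β] (w : β → ℝ) :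
    𝔼 y : β → Bool, Real.exp (∑ b, w b * sign (y b)) ≤ Real.exp ((∑ b, w b ^ 2) / 2) := by
  simp_rw [Real.exp_sum]
  rw [expect_prod_apply fun b y => Real.exp (w b * sign y), Finset.sum_div, Real.exp_sum]
  refine Finset.prod_le_prod (fun b _ => Finset.expect_nonneg fun _ _ => (Real.exp_pos _).le)
    fun b _ => ?_
  refine le_trans (le_of_eq ?_) (Real.cosh_le_exp_half_sq (w b))
  rw [Fintype.expect_eq_sum_div_card, Real.cosh_eq]
  simp [sign]
  ring

theorem gaussian_shift (s : ℝ) (x : ℝ) :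
    Real.exp (-x ^ 2 + s * x) = Real.exp (s ^ 2 / 4) * Real.exp (-1 * (x - s / 2) ^ 2) := by
  rw [← Real.exp_add]
  congr 1
  ring

theorem integrable_exp_neg_sq_add (s : ℝ) :
    MeasureTheory.Integrable fun x : ℝ => Real.exp (-x ^ 2 + s * x) := by
  simp_rw [gaussian_shift]
  exact ((integrable_exp_neg_mul_sq one_pos).comp_sub_right (s / 2)).const_mul _

theorem integral_exp_neg_sq_add (s : ℝ) :
    ∫ x : ℝ, Real.exp (-x ^ 2 + s * x) = Real.exp (s ^ 2 / 4) * √Real.pi := by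
  simp_rw [gaussian_shift]
  rw [MeasureTheory.integral_const_mul,
    MeasureTheory.integral_sub_right_eq_self (fun x : ℝ => Real.exp (-1 * x ^ 2)),
    integral_gaussian, div_one]

/-- Gaussian linearization: exp(s²/4) √π is the integral of exp(-x² + s x), which makes the exponent
linear in the signs. The subgaussian bound then leaves the integral of exp(-x²/2), that is √2 √π. -/
theorem expect_exp_sq_sign_sum_le {β : Type*} [Fintype β] [DecidableEq β] (w : β → ℝ)
    (hw : ∑ b, w b ^ 2 ≤ 1) :
    𝔼 y : β → Bool, Real.exp ((∑ b, w b * sign (y b)) ^ 2 / 4) ≤ √2 := by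
  have hpi : 0 < √Real.pi := Real.sqrt_pos.2 Real.pi_pos
  have key : (𝔼 y : β → Bool, Real.exp ((∑ b, w b * sign (y b)) ^ 2 / 4)) * √Real.pi ≤
      √2 * √Real.pi := by
    calc _ = 𝔼 y : β → Bool, ∫ x : ℝ, Real.exp (-x ^ 2 + (∑ b, w b * sign (y b)) * x) := by
          rw [Finset.expect_mul]
          simp_rw [integral_exp_neg_sq_add]
      _ = ∫ x : ℝ, 𝔼 y : β → Bool, Real.exp (-x ^ 2 + (∑ b, w b * sign (y b)) * x) := by
          simp_rw [Fintype.expect_eq_sum_div_card]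
          rw [MeasureTheory.integral_div, MeasureTheory.integral_finsetSum]
          exact fun y _ => integrable_exp_neg_sq_add _
      _ ≤ ∫ x : ℝ, Real.exp (-(1 / 2) * x ^ 2) := by
          refine MeasureTheory.integral_mono ?_ (integrable_exp_neg_mul_sq (by norm_num)) ?_
          · simp_rw [Fintype.expect_eq_sum_div_card]
            exact (MeasureTheory.integrable_finsetSum _
              fun y _ => integrable_exp_neg_sq_add _).div_const _
          · intro x
            simp only [Real.exp_add, ← Finset.mul_expect]
            have h := expect_exp_sign_sum_le fun b => w b * x
            have h2 : ∀ y : β → Bool, ∑ b, w b * x * sign (y b) =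
                (∑ b, w b * sign (y b)) * x := fun y => by
              rw [Finset.sum_mul]
              exact Finset.sum_congr rfl fun b _ => by ring
            simp_rw [h2] at h
            calc _ ≤ Real.exp (-x ^ 2) * Real.exp ((∑ b, (w b * x) ^ 2) / 2) :=
                  mul_le_mul_of_nonneg_left h (Real.exp_pos _).le
              _ ≤ Real.exp (-(1 / 2) * x ^ 2) := by
                  rw [← Real.exp_add]
                  refine Real.exp_le_exp.2 ?_
                  simp_rw [mul_pow]
                  rw [← Finset.sum_mul]
                  nlinarith [mul_le_mul_of_nonneg_right hw (sq_nonneg x)]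
      _ = √2 * √Real.pi := by
          rw [integral_gaussian, ← Real.sqrt_mul (by norm_num)]
          congr 1
          ring
  exact le_of_mul_le_mul_right key hpi

/-- Exponential moment of a bilinear form in independent random signs. -/
theorem expect_exp_bilinear_le {α β : Type*} [Fintype α] [DecidableEq α] [Fintype β]
    [DecidableEq β] (B : α → β → ℝ) {D : ℝ} (hD : 0 < D) (hB : ∑ l, ∑ r, B l r ^ 2 = D) :
    𝔼 p : (α → Bool) × (β → Bool),
      Real.exp ((∑ l, ∑ r, B l r * sign (p.1 l) * sign (p.2 r)) / √(2 * D)) ≤ √2 := by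
  set d : α → ℝ := fun l => ∑ r, B l r ^ 2 with hd
  set h : α → (β → Bool) → ℝ := fun l y => ∑ r, B l r * sign (y r) with hh
  have hd0 : ∀ l, 0 ≤ d l := fun l => Finset.sum_nonneg fun r _ => sq_nonneg _
  have hh0 : ∀ l y, d l = 0 → h l y = 0 := fun l y hl => by
    refine Finset.sum_eq_zero fun r _ => ?_
    have := (Finset.sum_eq_zero_iff_of_nonneg fun r _ => sq_nonneg (B l r)).1 hl r
      (Finset.mem_univ r)
    rw [pow_eq_zero_iff two_ne_zero] at this
    rw [this, zero_mul]
  have hs : 0 < √(2 * D) := Real.sqrt_pos.2 (by linarith)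
  have hs2 : √(2 * D) ^ 2 = 2 * D := Real.sq_sqrt (by linarith)
  have hx : ∀ y : β → Bool, 𝔼 x : α → Bool,
      Real.exp ((∑ l, ∑ r, B l r * sign (x l) * sign (y r)) / √(2 * D)) ≤
      ∑ l, d l / D * Real.exp (h l y ^ 2 / (4 * d l)) := fun y => by
    calc _ = 𝔼 x : α → Bool, Real.exp (∑ l, (h l y / √(2 * D)) * sign (x l)) := by
          refine Finset.expect_congr rfl fun x _ => ?_
          rw [Finset.sum_div]
          refine congrArg _ (Finset.sum_congr rfl fun l _ => ?_)
          rw [hh, div_mul_eq_mul_div, Finset.sum_mul]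
          exact congrArg (· / √(2 * D)) (Finset.sum_congr rfl fun r _ => by ring)
      _ ≤ Real.exp ((∑ l, (h l y / √(2 * D)) ^ 2) / 2) := expect_exp_sign_sum_le _
      _ = Real.exp (∑ l, (d l / D) • (h l y ^ 2 / (4 * d l))) := by
          rw [Finset.sum_div]
          refine congrArg _ (Finset.sum_congr rfl fun l _ => ?_)
          rw [div_pow, hs2, smul_eq_mul]
          by_cases hl : d l = 0
          · simp [hl, hh0 l y hl]
          · field_simp
            ring
      -- Jensen's inequality: the weights `d l / D` sum to 1. It separates the rows, so that each
      -- linear form `h l` can be normalized by its own variance `d l`.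
      _ ≤ ∑ l, (d l / D) • Real.exp (h l y ^ 2 / (4 * d l)) := by
          refine convexOn_exp.map_sum_le (fun l _ => div_nonneg (hd0 l) hD.le) ?_
            fun _ _ => Set.mem_univ _
          rw [← Finset.sum_div, hB, div_self hD.ne']
  have hy : ∀ l, 𝔼 y : β → Bool, d l / D * Real.exp (h l y ^ 2 / (4 * d l)) ≤ d l / D * √2 :=
    fun l => by
      rw [← Finset.mul_expect]
      refine mul_le_mul_of_nonneg_left ?_ (div_nonneg (hd0 l) hD.le)
      by_cases hl : d l = 0
      -- For a zero row the quotient is 0 by the convention for division by zero, and the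
      -- exponential is 1.
      · simp only [hl, mul_zero, div_zero, Real.exp_zero, Fintype.expect_const]
        exact Real.one_le_sqrt.2 (by norm_num)
      · have hl' : 0 < d l := lt_of_le_of_ne (hd0 l) (Ne.symm hl)
        have hsl : √(d l) ^ 2 = d l := Real.sq_sqrt (hd0 l)
        have h3 := expect_exp_sq_sign_sum_le (fun r => B l r / √(d l)) (by
          simp_rw [div_pow, hsl]
          rw [← Finset.sum_div]
          exact (div_self hl).le)
        refine le_trans (le_of_eq (Finset.expect_congr rfl fun y _ => congrArg _ ?_)) h3
        have h4 : ∑ r, B l r / √(d l) * sign (y r) = h l y / √(d l) := by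
          rw [hh, Finset.sum_div]
          exact Finset.sum_congr rfl fun r _ => by ring
        rw [h4, div_pow, hsl, div_div, mul_comm]
  rw [← Finset.univ_product_univ, Finset.expect_product, Finset.expect_comm]
  calc _ ≤ 𝔼 y : β → Bool, ∑ l, d l / D * Real.exp (h l y ^ 2 / (4 * d l)) :=
        Finset.expect_le_expect fun y _ => hx y
    _ = ∑ l, 𝔼 y : β → Bool, d l / D * Real.exp (h l y ^ 2 / (4 * d l)) :=
        Finset.expect_sum_comm _ _ _
    _ ≤ ∑ l, d l / D * √2 := Finset.sum_le_sum fun l _ => hy l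
    _ = √2 := by rw [← Finset.sum_mul, ← Finset.sum_div, hB, div_self hD.ne', one_mul]

/-- Flipping all signs of the first argument negates the form. -/
theorem expect_bilinear_eq_zero {α β : Type*} [Fintype α] [DecidableEq α] [Fintype β]
    [DecidableEq β] (B : α → β → ℝ) :
    𝔼 p : (α → Bool) × (β → Bool), ∑ l, ∑ r, B l r * sign (p.1 l) * sign (p.2 r) = 0 := by
  have h := Fintype.expect_equiv
    ((Equiv.piCongrRight fun _ : α => Equiv.boolNot).prodCongr (Equiv.refl (β → Bool)))
    (fun p => -∑ l, ∑ r, B l r * sign (p.1 l) * sign (p.2 r))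
    (fun p => ∑ l, ∑ r, B l r * sign (p.1 l) * sign (p.2 r)) fun p => by
      simp [sign_not]
  rw [Finset.expect_neg_distrib] at h
  linarith

/-! ### Hidden matching against a fixed list of answers -/

section HiddenMatching

variable {m : ℕ}

/-- The answer `c` is valid for the hidden matching problem with matching `a` and string `z`. -/
def ValidAnswer (z : BitString (2 * m)) (a : Fin m) (c : Fin (2 * m) × Fin (2 * m) × Bool) : Prop :=
  (c.1, c.2.1) ∈ matching m a ∧ c.2.2 = xor (z c.1) (z c.2.1)

open Classical in
/-- The number of matchings for which the list `l` gives a valid answer. -/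
noncomputable def hits (l : Fin m → Fin (2 * m) × Fin (2 * m) × Bool) (z : BitString (2 * m)) : ℕ :=
  (Finset.univ.filter fun a => ValidAnswer z a (l a)).card

/-- The vertex `ℓ` on the left side. -/
def leftVertex (i : Fin m) : Fin (2 * m) := ⟨i, by omega⟩

/-- The vertex `m + r` on the right side. -/
def rightVertex (i : Fin m) : Fin (2 * m) := ⟨m + i, by omega⟩

theorem equidistributed_halves (m : ℕ) : Equidistributed fun (z : BitString (2 * m)) =>
    ((fun i => z (leftVertex i), fun i => z (rightVertex i)) :
      (Fin m → Bool) × (Fin m → Bool)) := by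
  have hinj : Function.Injective (Sum.elim leftVertex rightVertex :
      Fin m ⊕ Fin m → Fin (2 * m)) := by
    rintro (i | i) (j | j) h
    all_goals
      have h' := congrArg Fin.val h
      simp only [Sum.elim_inl, Sum.elim_inr, leftVertex, rightVertex] at h'
    · exact congrArg _ (Fin.ext h')
    · omega
    · omega
    · exact congrArg _ (Fin.ext (by omega))
  exact (Equidistributed.of_equiv (Equiv.sumArrowEquivProdArrow (Fin m) (Fin m) Bool)).comp
    (Equidistributed.comp_injective (γ := Bool) hinj)

/-- The signed weight of the edge with left end `ℓ` in the answer for the matching `a`. -/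
noncomputable def edgeWeight (l : Fin m → Fin (2 * m) × Fin (2 * m) × Bool) (a ℓ : Fin m) : ℝ :=
  if (l a).1 = leftVertex ℓ ∧ (l a).2.1 = rightVertex (a + ℓ) then sign (l a).2.2 else 0

theorem leftVertex_injective : Function.Injective (leftVertex (m := m)) := fun i j h =>
  Fin.ext (by simpa [leftVertex] using h)

theorem mem_matching_iff {a : Fin m} {e : Fin (2 * m) × Fin (2 * m)} :
    e ∈ matching m a ↔ ∃ ℓ, e.1 = leftVertex ℓ ∧ e.2 = rightVertex (a + ℓ) := by
  simp [matching, Fin.ext_iff, leftVertex, rightVertex, Fin.val_add]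

theorem sum_edgeWeight_sq_le (l : Fin m → Fin (2 * m) × Fin (2 * m) × Bool) (a : Fin m) :
    ∑ ℓ, edgeWeight l a ℓ ^ 2 ≤ 1 := by
  by_cases h : ∃ ℓ, (l a).1 = leftVertex ℓ ∧ (l a).2.1 = rightVertex (a + ℓ)
  · obtain ⟨ℓ₀, h₀⟩ := h
    rw [Finset.sum_eq_single ℓ₀]
    · rw [edgeWeight, if_pos h₀, sq, sign_mul_self]
    · intro ℓ _ hℓ
      rw [edgeWeight, if_neg, zero_pow two_ne_zero]
      exact fun h' => hℓ (leftVertex_injective (h'.1.symm.trans h₀.1))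
    · simp
  · push Not at h
    rw [Finset.sum_eq_zero]
    · exact zero_le_one
    · intro ℓ _
      rw [edgeWeight, if_neg fun h' => h ℓ h'.1 h'.2, zero_pow two_ne_zero]

open Classical in
-- At most one term on the right is nonzero. It is 1 for a valid answer and -1 for an edge of the
-- matching with the wrong bit; an edge outside the matching gives 0, which is why this is only an
-- inequality.
theorem two_mul_ite_valid_sub_one_le (l : Fin m → Fin (2 * m) × Fin (2 * m) × Bool)
    (z : BitString (2 * m)) (a : Fin m) :
    2 * (if ValidAnswer z a (l a) then (1 : ℝ) else 0) - 1 ≤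
      ∑ ℓ, edgeWeight l a ℓ * sign (z (leftVertex ℓ)) * sign (z (rightVertex (a + ℓ))) := by
  by_cases h : ∃ ℓ, (l a).1 = leftVertex ℓ ∧ (l a).2.1 = rightVertex (a + ℓ)
  · obtain ⟨ℓ₀, h₀⟩ := h
    rw [Finset.sum_eq_single ℓ₀]
    · rw [edgeWeight, if_pos h₀]
      split_ifs with hv
      · rw [hv.2, h₀.1, h₀.2, sign_xor, mul_assoc, mul_mul_mul_comm, sign_mul_self, sign_mul_self]
        norm_num
      · cases (l a).2.2 <;> cases z (leftVertex ℓ₀) <;> cases z (rightVertex (a + ℓ₀)) <;>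
          norm_num [sign]
    · intro ℓ _ hℓ
      rw [edgeWeight, if_neg, zero_mul, zero_mul]
      exact fun h' => hℓ (leftVertex_injective (h'.1.symm.trans h₀.1))
    · simp
  · have hv : ¬ ValidAnswer z a (l a) := fun hv => h (mem_matching_iff.1 hv.1)
    push Not at h
    rw [Finset.sum_eq_zero, if_neg hv]
    · norm_num
    · intro ℓ _
      rw [edgeWeight, if_neg fun h' => h ℓ h'.1 h'.2, zero_mul, zero_mul]

/-- The edge from ℓ to m + r lies in exactly one matching, that of index r - ℓ, so a sum over
matchings and their edges is a sum over all matrix entries. -/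
theorem sum_sum_sub [NeZero m] (f : Fin m → Fin m → Fin m → ℝ) :
    ∑ ℓ, ∑ r, f (r - ℓ) ℓ r = ∑ a, ∑ ℓ, f a ℓ (a + ℓ) := by
  rw [Finset.sum_comm (s := Finset.univ) (t := Finset.univ) (f := fun a ℓ => f a ℓ (a + ℓ))]
  refine Finset.sum_congr rfl fun ℓ _ => ?_
  refine (Fintype.sum_equiv (Equiv.addRight ℓ) _ _ fun a => ?_).symm
  simp

theorem two_mul_hits_sub_le [NeZero m] (l : Fin m → Fin (2 * m) × Fin (2 * m) × Bool)
    (z : BitString (2 * m)) :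
    2 * (hits l z : ℝ) - m ≤ ∑ ℓ, ∑ r, edgeWeight l (r - ℓ) ℓ * sign (z (leftVertex ℓ)) *
      sign (z (rightVertex r)) := by
  classical
  rw [sum_sum_sub fun a ℓ r =>
    edgeWeight l a ℓ * sign (z (leftVertex ℓ)) * sign (z (rightVertex r))]
  refine le_trans (le_of_eq ?_)
    (Finset.sum_le_sum fun a _ => two_mul_ite_valid_sub_one_le l z a)
  rw [Finset.sum_sub_distrib, ← Finset.mul_sum, Finset.sum_boole]
  simp only [sum_const, card_univ, Fintype.card_fin, nsmul_eq_mul, mul_one, hits]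

theorem expect_hits_le [NeZero m] (l : Fin m → Fin (2 * m) × Fin (2 * m) × Bool) :
    𝔼 z, (hits l z : ℝ) ≤ m / 2 := by
  have h0 := expect_bilinear_eq_zero fun ℓ r : Fin m => edgeWeight l (r - ℓ) ℓ
  rw [← (equidistributed_halves m).expect_real] at h0
  have h1 : 𝔼 z, (hits l z : ℝ) ≤ 𝔼 z : BitString (2 * m), ((m : ℝ) / 2 +
      (∑ ℓ, ∑ r, edgeWeight l (r - ℓ) ℓ *
      sign (z (leftVertex ℓ)) * sign (z (rightVertex r))) / 2) :=
    Finset.expect_le_expect fun z _ => by linarith [two_mul_hits_sub_le l z]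
  rw [Finset.expect_add_distrib, Fintype.expect_const, ← Finset.expect_div, h0] at h1
  linarith

/-- A fixed list of answers is correct for three quarters of the matchings with probability at most
`2 / 3`. -/
theorem expect_many_hits_le_two_thirds [NeZero m]
    (l : Fin m → Fin (2 * m) × Fin (2 * m) × Bool) :
    𝔼 z, (if 3 * m ≤ 4 * hits l z then (1 : ℝ) else 0) ≤ 2 / 3 := by
  have hm : (0 : ℝ) < m := by exact_mod_cast Nat.pos_of_ne_zero (NeZero.ne m)
  have h : 𝔼 z, (3 * m / 4 : ℝ) * (if 3 * m ≤ 4 * hits l z then (1 : ℝ) else 0) ≤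
      𝔼 z, (hits l z : ℝ) := Finset.expect_le_expect fun z _ => by
    split_ifs with hz
    · have : (3 * m : ℝ) ≤ 4 * hits l z := by exact_mod_cast hz
      linarith
    · rw [mul_zero]
      positivity
  rw [← Finset.mul_expect] at h
  have h2 := h.trans (expect_hits_le l)
  by_contra hcon
  push Not at hcon
  nlinarith [mul_lt_mul_of_pos_left hcon hm]

/-- A fixed list of answers is correct for three quarters of the matchings with exponentially small
probability. -/
theorem expect_many_hits_le_exp [NeZero m] (l : Fin m → Fin (2 * m) × Fin (2 * m) × Bool) :
    𝔼 z, (if 3 * m ≤ 4 * hits l z then (1 : ℝ) else 0) ≤ 2 * Real.exp (-(√m / 3)) := by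
  have hm : (0 : ℝ) < m := by exact_mod_cast Nat.pos_of_ne_zero (NeZero.ne m)
  set S : BitString (2 * m) → ℝ := fun z => ∑ ℓ, ∑ r, edgeWeight l (r - ℓ) ℓ *
      sign (z (leftVertex ℓ)) * sign (z (rightVertex r)) with hS
  have hS1 : ∀ z, 3 * m ≤ 4 * hits l z → (m : ℝ) / 2 ≤ S z := fun z hz => by
    have h1 : (3 * m : ℝ) ≤ 4 * hits l z := by exact_mod_cast hz
    linarith [two_mul_hits_sub_le l z]
  set D : ℝ := ∑ ℓ : Fin m, ∑ r, edgeWeight l (r - ℓ) ℓ ^ 2 with hD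
  have hD0 : 0 ≤ D := Finset.sum_nonneg fun _ _ => Finset.sum_nonneg fun _ _ => sq_nonneg _
  have hDm : D ≤ m := by
    rw [hD, sum_sum_sub fun a ℓ _ => edgeWeight l a ℓ ^ 2]
    calc _ ≤ ∑ _a : Fin m, (1 : ℝ) := Finset.sum_le_sum fun a _ => sum_edgeWeight_sq_le l a
      _ = m := by simp
  -- If `D = 0`, no answer names an edge of its matching; the form vanishes identically and cannot
  -- reach m/2.
  rcases hD0.eq_or_lt with hD0 | hD0
  · refine le_trans (le_of_eq (Finset.expect_eq_zero fun z _ => if_neg fun hz => ?_)) (by positivity)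
    have hz0 : S z = 0 := by
      refine Finset.sum_eq_zero fun ℓ _ => Finset.sum_eq_zero fun r _ => ?_
      have h1 := (Finset.sum_eq_zero_iff_of_nonneg fun ℓ _ => Finset.sum_nonneg
        fun r _ => sq_nonneg (edgeWeight l (r - ℓ) ℓ)).1 hD0.symm ℓ (Finset.mem_univ _)
      have h2 := (Finset.sum_eq_zero_iff_of_nonneg
        fun r _ => sq_nonneg (edgeWeight l (r - ℓ) ℓ)).1 h1 r (Finset.mem_univ _)
      rw [pow_eq_zero_iff two_ne_zero] at h2
      rw [h2, zero_mul, zero_mul]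
    linarith [hS1 z hz]
  · have h := expect_exp_bilinear_le (fun ℓ r : Fin m => edgeWeight l (r - ℓ) ℓ) hD0 rfl
    rw [← (equidistributed_halves m).expect_real] at h
    have hsD : 0 < √(2 * D) := Real.sqrt_pos.2 (by linarith)
    have hsm : 0 < √(m : ℝ) := Real.sqrt_pos.2 hm
    -- From D ≤ m and √2 ≤ 3/2: the threshold m/2, divided by √(2D), is at least √m/3.
    have hlow : √(m : ℝ) / 3 ≤ (m : ℝ) / 2 / √(2 * D) := by
      rw [div_le_div_iff₀ (by norm_num) hsD]
      have h1 : √(2 * D) ≤ 3 / 2 * √(m : ℝ) := by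
        rw [Real.sqrt_le_left (by positivity), mul_pow, Real.sq_sqrt hm.le]
        linarith
      calc √(m : ℝ) * √(2 * D) ≤ √(m : ℝ) * (3 / 2 * √(m : ℝ)) := by gcongr
        _ = (m : ℝ) / 2 * 3 := by
            linear_combination (3 / 2 : ℝ) * Real.mul_self_sqrt hm.le
    have h2 : 𝔼 z, Real.exp (√m / 3) * (if 3 * m ≤ 4 * hits l z then (1 : ℝ) else 0) ≤
        𝔼 z, Real.exp (S z / √(2 * D)) := Finset.expect_le_expect fun z _ => by
      split_ifs with hz
      · rw [mul_one]
        refine Real.exp_le_exp.2 (hlow.trans ?_)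
        gcongr
        exact hS1 z hz
      · rw [mul_zero]
        exact (Real.exp_pos _).le
    rw [← Finset.mul_expect] at h2
    have h3 : √(2 : ℝ) ≤ 2 := by
      rw [Real.sqrt_le_left (by norm_num)]
      norm_num
    rw [Real.exp_neg, ← div_eq_mul_inv, le_div_iff₀ (Real.exp_pos _), mul_comm]
    exact (h2.trans h).trans h3

end HiddenMatching

/-! ### Replacing the gadget by an independent uniform value -/

/-- Sum over all pairs of a view and a field element: the main terms average `good v` over a uniform
element, and each pair adds an error of at most ε. -/
theorem expect_le_of_nearly_independent {Y U F : Type*} [Fintype Y] [Fintype U]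
    [DecidableEq U] [Fintype F] [DecidableEq F] [Nonempty Y] (view : Y → U) (h : Y → F) {ε δ : ℝ}
    (hvh : ∀ v u, 𝔼 y, (if view y = v ∧ h y = u then (1 : ℝ) else 0) ≤
      (𝔼 y, if view y = v then (1 : ℝ) else 0) / Fintype.card F + ε)
    (hε : 0 ≤ ε) (good : U → F → ℝ) (hg0 : ∀ v u, 0 ≤ good v u) (hg1 : ∀ v u, good v u ≤ 1)
    (hgood : ∀ v, 𝔼 u, good v u ≤ δ) :
    𝔼 y, good (view y) (h y) ≤ δ + Fintype.card U * (Fintype.card F * ε) := by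
  have h1 : 𝔼 y, good (view y) (h y) =
      ∑ v, ∑ u, good v u * 𝔼 y, (if view y = v ∧ h y = u then (1 : ℝ) else 0) := by
    simp_rw [Finset.mul_expect]
    rw [← Finset.sum_congr rfl fun v _ => Finset.expect_sum_comm _ _ _,
      ← Finset.expect_sum_comm]
    refine Finset.expect_congr rfl fun y _ => ?_
    rw [Finset.sum_eq_single (view y), Finset.sum_eq_single (h y)]
    · simp
    · intro u _ hu
      simp [Ne.symm hu]
    · simp
    · intro v _ hv
      simp [Ne.symm hv]
    · simp
  have h2 : ∑ v, (𝔼 y, if view y = v then (1 : ℝ) else 0) = 1 := by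
    rw [← Finset.expect_sum_comm]
    simp
  rw [h1]
  calc _ ≤ ∑ v, ((𝔼 y, if view y = v then (1 : ℝ) else 0) * δ + Fintype.card F * ε) := by
        refine Finset.sum_le_sum fun v _ => ?_
        calc _ ≤ ∑ u, (good v u * ((𝔼 y, if view y = v then (1 : ℝ) else 0) / Fintype.card F) +
              ε) := by
              refine Finset.sum_le_sum fun u _ => ?_
              refine (mul_le_mul_of_nonneg_left (hvh v u) (hg0 v u)).trans ?_
              rw [mul_add]
              gcongr
              exact mul_le_of_le_one_left hε (hg1 v u)
          _ = (𝔼 y, if view y = v then (1 : ℝ) else 0) * (𝔼 u, good v u) +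
                Fintype.card F * ε := by
              rw [Finset.sum_add_distrib, ← Finset.sum_mul, Fintype.expect_eq_sum_div_card (good v),
                Finset.sum_const, Finset.card_univ, nsmul_eq_mul]
              ring
          _ ≤ _ := by
              gcongr
              exact hgood v
    _ = δ + Fintype.card U * (Fintype.card F * ε) := by
        rw [Finset.sum_add_distrib, ← Finset.sum_mul, h2, Finset.sum_const, Finset.card_univ,
          nsmul_eq_mul, one_mul]

/-! ### Transcripts as cylinder intersections -/

namespace Protocol

variable {k m : ℕ} {A Y Z : Type}

/-- The messages of the players `2, …, k` when player `1` is forced to send `w`. -/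
def forced (P : Protocol k A Y Z) (w : BitString P.len₁) (a : A) (y : Fin (k - 1) → Y)
    (i : Fin (k - 1)) : BitString (P.len i) :=
  P.msg i a (fun j => y j) w (fun j _ => P.forced w a y j)
termination_by i

theorem forced_msg₁ (P : Protocol k A Y Z) (a : A) (y : Fin (k - 1) → Y) :
    ∀ i, P.forced (P.msg₁ y) a y i = P.sent a y i := by
  intro i
  induction i using WellFoundedLT.induction with
  | ind i ih =>
    rw [forced, sent]
    congr 1
    funext j hj
    exact ih j hj

/-- The forced messages for all values of `x₁`, together with the answers they lead to. -/
def view (P : Protocol k (Fin m) Y Z) (w : BitString P.len₁) (y : Fin (k - 1) → Y) :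
    (Fin m → ∀ i, BitString (P.len i)) × (Fin m → Z) :=
  (fun a => P.forced w a y, fun a => P.out a (fun j => y j) w (P.forced w a y))

theorem view_msg₁_snd (P : Protocol k (Fin m) Y Z) (y : Fin (k - 1) → Y) (a : Fin m) :
    (P.view (P.msg₁ y) y).2 a = P.answer a y := by
  have h : P.forced (P.msg₁ y) a y = P.sent a y := funext (P.forced_msg₁ a y)
  change P.out a _ _ (P.forced (P.msg₁ y) a y) = _
  rw [answer, h]

/-- Each message is determined by the earlier ones, so a transcript is the true one as soon as every
player finds its own entry correct given the earlier entries. This turns a recursion into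
independent local checks. -/
theorem forced_eq_iff (P : Protocol k A Y Z) (w : BitString P.len₁) (a : A)
    (y : Fin (k - 1) → Y) (t : ∀ i, BitString (P.len i)) :
    P.forced w a y = t ↔ ∀ i, P.msg i a (fun j => y j) w (fun j _ => t j) = t i := by
  constructor
  · rintro rfl i
    exact (forced.eq_1 P w a y i).symm
  · intro h
    funext i
    induction i using WellFoundedLT.induction with
    | ind i ih =>
      rw [forced, ← h i]
      congr 1
      funext j hj
      exact ih j hj

/-- What player `i + 2` has to check for the view to be `v`. -/
def Consistent (P : Protocol k (Fin m) Y Z) (w : BitString P.len₁)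
    (v : (Fin m → ∀ i, BitString (P.len i)) × (Fin m → Z)) (i : Fin (k - 1))
    (y : Fin (k - 1) → Y) : Prop :=
  (∀ a, P.msg i a (fun j => y j) w (fun j _ => v.1 a j) = v.1 a i) ∧
    ((i : ℕ) + 2 = k → ∀ a, P.out a (fun j => y j) w (v.1 a) = v.2 a)

theorem consistent_update (P : Protocol k (Fin m) Y Z) (w : BitString P.len₁)
    (v : (Fin m → ∀ i, BitString (P.len i)) × (Fin m → Z)) (i : Fin (k - 1))
    (y : Fin (k - 1) → Y) (b : Y) :
    P.Consistent w v i (Function.update y i b) ↔ P.Consistent w v i y := by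
  have h1 : (fun j : {j : Fin (k - 1) // j ≠ i} => Function.update y i b j.1) =
      fun j => y j.1 :=
    funext fun j => Function.update_of_ne j.2 _ _
  have h2 : (i : ℕ) + 2 = k → (fun j : {j : Fin (k - 1) // (j : ℕ) + 2 ≠ k} =>
      Function.update y i b j.1) = fun j => y j.1 := fun hi =>
    funext fun j => Function.update_of_ne (fun h => j.2 (by rw [h, hi])) _ _
  unfold Consistent
  rw [h1]
  refine and_congr Iff.rfl (forall_congr' fun hi => ?_)
  rw [h2 hi]

/-- The answers have to be part of the view because they are not determined by the messages; player
k does not use its own input to produce them, so it can check them without leaving the cylinder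
structure. -/
theorem view_eq_iff (hk : 2 ≤ k) (P : Protocol k (Fin m) Y Z) (w : BitString P.len₁)
    (v : (Fin m → ∀ i, BitString (P.len i)) × (Fin m → Z)) (y : Fin (k - 1) → Y) :
    P.view w y = v ↔ ∀ i, P.Consistent w v i y := by
  obtain ⟨t, l⟩ := v
  rw [view, Prod.mk.injEq, funext_iff, funext_iff]
  simp_rw [forced_eq_iff]
  constructor
  · rintro ⟨h1, h2⟩ i
    refine ⟨fun a => h1 a i, fun _ a => ?_⟩
    change P.out a _ w (t a) = l a
    rw [← (P.forced_eq_iff w a y (t a)).2 (h1 a)]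
    exact h2 a
  · intro h
    have h1 : ∀ a i, P.msg i a (fun j => y j) w (fun j _ => t a j) = t a i :=
      fun a i => (h i).1 a
    refine ⟨h1, fun a => ?_⟩
    rw [(P.forced_eq_iff w a y (t a)).2 (h1 a)]
    exact (h ⟨k - 2, by omega⟩).2 (by simp only; omega) a

theorem sent_simplify (P : Protocol k (Fin m) Y Z) (a : Fin m) (y : Fin (k - 1) → Y) :
    ∀ i b, P.simplify.sent a y i b =
      P.sent (finProdFinEquiv.symm b).1 y i (finProdFinEquiv.symm b).2 := by
  intro i
  induction i using WellFoundedLT.induction with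
  | ind i ih =>
    intro b
    rw [sent, sent]
    change P.msg i (finProdFinEquiv.symm b).1 _ _
      (fun j _ c => P.simplify.sent a y j (finProdFinEquiv ((finProdFinEquiv.symm b).1, c))) _ = _
    congr 2
    funext j hj c
    exact (ih j hj _).trans (by simp)

theorem answer_simplify (P : Protocol k (Fin m) Y Z) (a : Fin m) (y : Fin (k - 1) → Y) :
    P.simplify.answer a y = P.answer a y := by
  rw [answer, answer]
  change P.out a _ _ (fun i c => P.simplify.sent a y i (finProdFinEquiv (a, c))) = _
  congr 1
  funext i c
  refine (P.sent_simplify a y i (finProdFinEquiv (a, c))).trans ?_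
  simp

theorem card_view [Fintype Z] (P : Protocol k (Fin m) Y Z) :
    Fintype.card ((Fin m → ∀ i, BitString (P.len i)) × (Fin m → Z)) =
      2 ^ (∑ i, P.simplify.len i) * Fintype.card Z ^ m := by
  have h : ∑ i, P.simplify.len i = (∑ i, P.len i) * m := by
    rw [mul_comm, Finset.mul_sum]
    rfl
  rw [Fintype.card_prod, Fintype.card_fun, Fintype.card_fun, Fintype.card_fin, Fintype.card_pi, h,
    pow_mul]
  simp only [Fintype.card_fun, Fintype.card_fin, Fintype.card_bool, Finset.prod_pow_eq_pow_sum]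

end Protocol

/-! ### From small error to a communication inequality -/

/-- `norm_expect_gip_eq_sub_le` for the players `2, …, k` of a protocol. -/
theorem expect_gip_eq_le {k : ℕ} (hk : 2 ≤ k) {ι F V : Type*} [Fintype ι] [DecidableEq ι] [Field F]
    [Fintype F] [DecidableEq F] [Fintype V] [Nonempty V] {φ : V → ι → F} (hφ : Equidistributed φ)
    (p : Fin (k - 1) → (Fin (k - 1) → V) → Prop)
    (hind : ∀ i x v, p i (Function.update x i v) ↔ p i x) {ε : ℝ} (hε : 0 ≤ ε)
    (hKε : (((k - 2 : ℕ) : ℝ) / Fintype.card F) ^ Fintype.card ι ≤ ε ^ 2 ^ (k - 2)) (u : F)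
    (E : (Fin (k - 1) → V) → Prop) [DecidablePred E] (hE : ∀ x, E x ↔ ∀ i, p i x) :
    𝔼 x, (if E x ∧ ∑ j, ∏ i, φ (x i) j = u then (1 : ℝ) else 0) ≤
      (𝔼 x, if E x then (1 : ℝ) else 0) / Fintype.card F + ε := by
  classical
  obtain ⟨K, rfl⟩ : ∃ K, k = K + 2 := ⟨k - 2, by omega⟩
  have h := norm_expect_gip_eq_sub_le (V := V) hφ K (fun i x => if p i x then (1 : ℂ) else 0)
    (fun i x => by split_ifs <;> simp) (fun i x v => by simp only [hind i x v]) hε hKε u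
  have hprod : ∀ x : Fin (K + 1) → V, ∏ i : Fin (K + 1), (if p i x then (1 : ℂ) else 0) =
      if E x then 1 else 0 := fun x => by
    by_cases hx : ∀ i, p i x
    · rw [if_pos ((hE x).2 hx)]
      exact Finset.prod_eq_one fun i _ => if_pos (hx i)
    · rw [if_neg fun h' => hx ((hE x).1 h')]
      push Not at hx
      obtain ⟨i, hi⟩ := hx
      exact Finset.prod_eq_zero (Finset.mem_univ i) (if_neg hi)
  simp only [hprod] at h
  have h' : ‖(((𝔼 x : Fin (K + 1) → V, (if E x ∧ ∑ j, ∏ i, φ (x i) j = u then (1 : ℝ) else 0)) -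
      (𝔼 x : Fin (K + 1) → V, if E x then (1 : ℝ) else 0) / Fintype.card F : ℝ) : ℂ)‖ ≤ ε := by
    refine le_trans (le_of_eq (congrArg _ ?_)) h
    rw [Complex.ofReal_sub, Complex.ofReal_div, Complex.ofReal_expect, Complex.ofReal_expect,
      Complex.ofReal_natCast]
    congr 1
    · refine Finset.expect_congr rfl fun x _ => ?_
      by_cases h1 : E x <;> by_cases h2 : ∑ j, ∏ i, φ (x i) j = u <;> simp [h1, h2]
    · congr 1
      refine Finset.expect_congr rfl fun x _ => ?_
      split_ifs <;> simp
  rw [Complex.norm_real] at h'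
  have := (abs_le.1 h').2
  exact sub_le_iff_le_add'.1 this

theorem Protocol.error_liftedHM_eq {k n m : ℕ} [NeZero m]
    (g : (Fin (k - 1) → BitString n) → BitString (2 * m))
    (P : Protocol k (Fin m) (BitString n) (Fin (2 * m) × Fin (2 * m) × Bool)) :
    P.error (liftedHM g) = 𝔼 y, (1 - (hits (fun a => P.answer a y) (g y) : ℝ) / m) := by
  classical
  have hm : (m : ℝ) ≠ 0 := by exact_mod_cast NeZero.ne m
  have h1 : P.error (liftedHM g) = 𝔼 x : Fin m × (Fin (k - 1) → BitString n),
      (if ¬ liftedHM g x.1 x.2 (P.answer x.1 x.2) then (1 : ℝ) else 0) := by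
    rw [Protocol.error, Fintype.expect_eq_sum_div_card, Finset.sum_boole]
  rw [h1, ← Finset.univ_product_univ, Finset.expect_product, Finset.expect_comm]
  refine Finset.expect_congr rfl fun y _ => ?_
  have h2 : ∀ a, (if ¬ liftedHM g a y (P.answer a y) then (1 : ℝ) else 0) =
      1 - if ValidAnswer (g y) a (P.answer a y) then (1 : ℝ) else 0 := fun a => by
    have h3 : liftedHM g a y (P.answer a y) ↔ ValidAnswer (g y) a (P.answer a y) := Iff.rfl
    by_cases h : ValidAnswer (g y) a (P.answer a y)
    · rw [if_neg (not_not.2 (h3.2 h)), if_pos h, sub_self]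
    · rw [if_pos (mt h3.1 h), if_neg h, sub_zero]
  simp_rw [h2]
  rw [Fintype.expect_eq_sum_div_card, Finset.sum_sub_distrib, Finset.sum_boole, Fintype.card_fin,
    sub_div]
  simp only [sum_const, card_univ, Fintype.card_fin, nsmul_eq_mul, mul_one, hits, div_self hm]

/-- Markov's inequality in the form 1 - 4t ≤ [t ≤ 1/4], where t is the fraction of invalid answers;
it averages to at least 1 - 4/16. -/
theorem Protocol.three_quarters_le_expect_many_hits {k n m : ℕ} [NeZero m]
    {g : (Fin (k - 1) → BitString n) → BitString (2 * m)}
    {P : Protocol k (Fin m) (BitString n) (Fin (2 * m) × Fin (2 * m) × Bool)}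
    (herr : P.error (liftedHM g) ≤ 1 / 16) :
    3 / 4 ≤ 𝔼 y, (if 3 * m ≤ 4 * hits (fun a => P.answer a y) (g y) then (1 : ℝ) else 0) := by
  have hm : (0 : ℝ) < m := by exact_mod_cast Nat.pos_of_ne_zero (NeZero.ne m)
  rw [P.error_liftedHM_eq] at herr
  have h : 𝔼 y, (1 - 4 * (1 - (hits (fun a => P.answer a y) (g y) : ℝ) / m)) ≤
      𝔼 y, (if 3 * m ≤ 4 * hits (fun a => P.answer a y) (g y) then (1 : ℝ) else 0) := by
    refine Finset.expect_le_expect fun y _ => ?_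
    have hle : hits (fun a => P.answer a y) (g y) ≤ m :=
      (Finset.card_le_univ _).trans (Fintype.card_fin m).le
    split_ifs with hy
    · have : (hits (fun a => P.answer a y) (g y) : ℝ) / m ≤ 1 :=
        div_le_one_of_le₀ (by exact_mod_cast hle) hm.le
      linarith
    · push Not at hy
      have h1 : 4 * (hits (fun a => P.answer a y) (g y) : ℝ) ≤ 3 * m := by exact_mod_cast hy.le
      have : (hits (fun a => P.answer a y) (g y) : ℝ) / m ≤ 3 / 4 := by
        rw [div_le_div_iff₀ hm (by norm_num)]
        linarith
      linarith
  rw [Finset.expect_sub_distrib, Fintype.expect_const, ← Finset.mul_expect] at h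
  linarith

theorem equidistributed_blocks {k n : ℕ} {F : Type} [Fintype F]
    (e : F ≃ BitString (fieldBits k n)) :
    Equidistributed fun (x : BitString n) (j : Fin (2 ^ k)) => e.symm (block x j) := by
  have hinj : Function.Injective fun p : Fin (2 ^ k) × Fin (fieldBits k n) =>
      (⟨(p.1 : ℕ) * fieldBits k n + p.2, block_index_lt p.1 p.2⟩ : Fin n) := by
    rintro ⟨i, a⟩ ⟨j, b⟩ h
    have hN : 0 < fieldBits k n := Fin.pos a
    have h' : (a : ℕ) + fieldBits k n * i = b + fieldBits k n * j := by
      have := congrArg Fin.val h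
      simp only at this
      linarith
    have h1 := congrArg (· / fieldBits k n) h'
    have h2 := congrArg (· % fieldBits k n) h'
    simp only [Nat.add_mul_div_left _ _ hN, Nat.div_eq_of_lt a.2, Nat.div_eq_of_lt b.2,
      zero_add] at h1
    simp only [Nat.add_mul_mod_self_left, Nat.mod_eq_of_lt a.2, Nat.mod_eq_of_lt b.2] at h2
    rw [Prod.mk.injEq]
    exact ⟨Fin.ext h1, Fin.ext h2⟩
  exact (Equidistributed.of_equiv (Equiv.piCongrRight fun _ : Fin (2 ^ k) => e.symm)).comp
    ((Equidistributed.of_equiv (Equiv.curry (Fin (2 ^ k)) (Fin (fieldBits k n)) Bool)).comp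
      (Equidistributed.comp_injective (γ := Bool) hinj))

theorem equidistributed_prefix {k n : ℕ} {F : Type} [Fintype F]
    (e : F ≃ BitString (fieldBits k n)) :
    Equidistributed fun (u : F) (b : Fin (gadgetBits k n)) =>
      e u (Fin.castLE (gadgetBits_le k n) b) :=
  (Equidistributed.comp_injective (γ := Bool) (Fin.castLE_injective (gadgetBits_le k n))).comp
    (Equidistributed.of_equiv e)

/-- Communication needed for small error, in terms of the bounds `δ` for a fixed list of answers and
`ε` for the discrepancy of the generalized inner product. -/
theorem three_quarters_le_of_error_le {k n : ℕ} (hk : 2 ≤ k) [NeZero (numMatchings k n)] {F : Type}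
    [Field F] [Fintype F] [DecidableEq F] (e : F ≃ BitString (fieldBits k n))
    (P : Protocol k (Fin (numMatchings k n)) (BitString n)
      (Fin (gadgetBits k n) × Fin (gadgetBits k n) × Bool))
    (herr : P.simplify.error (liftedHM (gadget e)) ≤ 1 / 16) {ε δ : ℝ} (hε : 0 ≤ ε)
    (hKε : (((k - 2 : ℕ) : ℝ) / Fintype.card F) ^ 2 ^ k ≤ ε ^ 2 ^ (k - 2))
    (hδ : ∀ l : Fin (numMatchings k n) → Fin (gadgetBits k n) × Fin (gadgetBits k n) × Bool,
      𝔼 z, (if 3 * numMatchings k n ≤ 4 * hits l z then (1 : ℝ) else 0) ≤ δ) :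
    3 / 4 ≤ 2 ^ P.simplify.len₁ * (δ + 2 ^ (∑ i, P.simplify.len i) *
      (8 * (numMatchings k n : ℝ) ^ 2) ^ numMatchings k n * (Fintype.card F * ε)) := by
  classical
  set φ : BitString n → Fin (2 ^ k) → F := fun x j => e.symm (block x j) with hφ
  set h : (Fin (k - 1) → BitString n) → F := fun y => ∑ j, ∏ i, φ (y i) j with hh
  set good : ((Fin (numMatchings k n) → ∀ i, BitString (P.len i)) × (Fin (numMatchings k n) →
    Fin (gadgetBits k n) × Fin (gadgetBits k n) × Bool)) →
    F → ℝ := fun v u => if 3 * numMatchings k n ≤ 4 * hits v.2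
      (fun b => e u (Fin.castLE (gadgetBits_le k n) b)) then (1 : ℝ) else 0 with hgood
  have hw : ∀ w, 𝔼 y, good (P.view w y) (h y) ≤ δ + 2 ^ (∑ i, P.simplify.len i) *
      (8 * (numMatchings k n : ℝ) ^ 2) ^ numMatchings k n * (Fintype.card F * ε) := fun w => by
    have h1 := expect_le_of_nearly_independent (P.view w) h (ε := ε) (δ := δ) ?_ hε good ?_ ?_ ?_
    · rw [P.card_view] at h1
      refine h1.trans (le_of_eq ?_)
      simp only [Fintype.card_prod, Fintype.card_fin, Fintype.card_bool]
      push_cast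
      ring
    · intro v u
      exact expect_gip_eq_le hk (equidistributed_blocks e) (P.Consistent w v)
        (P.consistent_update w v) hε (by rwa [Fintype.card_fin]) u _ (P.view_eq_iff hk w v)
    · intro v u
      simp only [hgood]
      split_ifs <;> norm_num
    · intro v u
      simp only [hgood]
      split_ifs <;> norm_num
    · intro v
      refine le_trans (le_of_eq ?_) (hδ v.2)
      exact (equidistributed_prefix e).expect_real
        fun z => if 3 * numMatchings k n ≤ 4 * hits v.2 z then (1 : ℝ) else 0
  calc (3 / 4 : ℝ) ≤ 𝔼 y, (if 3 * numMatchings k n ≤ 4 *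
        hits (fun a => P.simplify.answer a y) (gadget e y) then (1 : ℝ) else 0) := Protocol.three_quarters_le_expect_many_hits herr
    -- The true message of player 1 depends on all the inputs behind the gadget, so conditioning on
    -- it would destroy the cylinder structure. Instead every `w` is tried on every input, and the
    -- term of the true message already accounts for the event.
    _ ≤ 𝔼 y, ∑ w, good (P.view w y) (h y) := by
        refine Finset.expect_le_expect fun y _ => ?_
        refine le_trans (le_of_eq ?_) (Finset.single_le_sum (f := fun w => good (P.view w y) (h y))
          (fun w _ => ?_) (Finset.mem_univ (P.msg₁ y)))
        · simp only [hgood]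
          have h2 : (P.view (P.msg₁ y) y).2 = fun a => P.simplify.answer a y :=
            funext fun a => (P.view_msg₁_snd y a).trans (P.answer_simplify a y).symm
          rw [h2]
          rfl
        · simp only [hgood]
          split_ifs <;> norm_num
    _ = ∑ w, 𝔼 y, good (P.view w y) (h y) := Finset.expect_sum_comm _ _ _
    _ ≤ ∑ _w : BitString P.len₁, (δ + 2 ^ (∑ i, P.simplify.len i) *
      (8 * (numMatchings k n : ℝ) ^ 2) ^ numMatchings k n * (Fintype.card F * ε)) :=
        Finset.sum_le_sum fun w _ => hw w
    _ = _ := by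
        rw [Finset.sum_const, Finset.card_univ, nsmul_eq_mul]
        simp [Protocol.simplify]

/-! ### Numerical estimates -/

theorem two_pow_le_fieldBits {k n : ℕ} (hk : 2 ≤ k) (hkn : (k : ℝ) ≤ Real.logb 2 n / 2) :
    2 ^ k ≤ fieldBits k n := by
  have hn : n ≠ 0 := by
    rintro rfl
    have : (2 : ℝ) ≤ k := by exact_mod_cast hk
    simp at hkn
    linarith
  have hn' : (0 : ℝ) < n := by exact_mod_cast Nat.pos_of_ne_zero hn
  have h1 : ((2 * k : ℕ) : ℝ) ≤ Real.logb 2 n := by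
    push_cast
    linarith
  rw [Real.le_logb_iff_rpow_le (by norm_num) hn', Real.rpow_natCast] at h1
  have h2 : 2 ^ (2 * k) ≤ n := by exact_mod_cast h1
  rw [fieldBits, Nat.le_div_iff_mul_le (by positivity), ← pow_add, ← two_mul]
  exact h2

theorem gadgetBits_pow_three_le (k n : ℕ) : (gadgetBits k n) ^ 3 ≤ (fieldBits k n) ^ 2 := by
  have h1 : (numMatchings k n : ℝ) ≤ (fieldBits k n : ℝ) ^ (2 / 3 : ℝ) / 2 :=
    Nat.floor_le (by positivity)
  have h2 : ((gadgetBits k n : ℕ) : ℝ) ≤ (fieldBits k n : ℝ) ^ (2 / 3 : ℝ) := by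
    push_cast [gadgetBits]
    linarith
  have h3 : ((gadgetBits k n : ℕ) : ℝ) ^ 3 ≤ (fieldBits k n : ℝ) ^ 2 := by
    refine (pow_le_pow_left₀ (by positivity) h2 3).trans (le_of_eq ?_)
    rw [← Real.rpow_natCast, ← Real.rpow_mul (by positivity), ← Real.rpow_natCast]
    norm_num
  exact_mod_cast h3

/-- The lists of answers are short compared with the elements of the field. -/
theorem answers_sq_le {m N : ℕ} (hm : 0 < m) (h : (2 * m) ^ 3 ≤ N ^ 2) :
    ((8 * (m : ℝ) ^ 2) ^ m) ^ 2 ≤ 2 ^ (3 * N) := by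
  have hm' : (0 : ℝ) < m := by exact_mod_cast hm
  set s : ℝ := √(2 * m) with hs
  have hs0 : 0 < s := Real.sqrt_pos.2 (by linarith)
  have hs2 : s ^ 2 = 2 * m := Real.sq_sqrt (by linarith)
  have hsN : s ^ 3 ≤ N := by
    refine (pow_le_pow_iff_left₀ (by positivity) (by positivity) two_ne_zero).1 ?_
    calc (s ^ 3) ^ 2 = (s ^ 2) ^ 3 := by ring
      _ = (2 * (m : ℝ)) ^ 3 := by rw [hs2]
      _ ≤ (N : ℝ) ^ 2 := by exact_mod_cast h
  -- Tangent line of the logarithm at s = 2. It gives log 2 + 4 log s ≤ 2s + (5 log 2 - 4) ≤ 3 s log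
  -- 2.
  have hlog : Real.log s ≤ s / 2 - 1 + Real.log 2 := by
    have h1 := Real.log_le_sub_one_of_pos (x := s / 2) (by linarith)
    rw [Real.log_div hs0.ne' two_ne_zero] at h1
    linarith
  have h8 : 8 * (m : ℝ) ^ 2 = 2 * s ^ 4 := by
    have : s ^ 4 = (s ^ 2) ^ 2 := by ring
    rw [this, hs2]
    ring
  have hl2 := Real.log_two_lt_d9
  have hl2' := Real.log_two_gt_d9
  rw [← Real.log_le_log_iff (by positivity) (by positivity), ← pow_mul, Real.log_pow, Real.log_pow,
    h8, Real.log_mul two_ne_zero (by positivity), Real.log_pow]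
  push_cast
  calc (m : ℝ) * 2 * (Real.log 2 + 4 * Real.log s) ≤ m * 2 * (3 * s * Real.log 2) := by
        gcongr
        nlinarith
    _ = 3 * s ^ 3 * Real.log 2 := by
        rw [mul_comm (m : ℝ) 2, ← hs2]
        ring
    _ ≤ 3 * N * Real.log 2 := by
        have : 0 ≤ Real.log 2 := by linarith
        gcongr

theorem pow_eight_le {K N : ℕ} (h : 2 ^ (K + 2) ≤ N) : K ^ 8 ≤ 2 ^ N := by
  have h1 : 2 * K ≤ 2 ^ K := by
    induction K with
    | zero => simp
    | succ K ih =>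
      rcases Nat.eq_zero_or_pos K with rfl | hK
      · norm_num
      · have h2 := ih ((Nat.pow_le_pow_right (by norm_num) (by omega)).trans h)
        rw [pow_succ]
        omega
  calc K ^ 8 ≤ (2 ^ K) ^ 8 := Nat.pow_le_pow_left Nat.lt_two_pow_self.le 8
    _ = 2 ^ (4 * (2 * K)) := by
        rw [← pow_mul]
        congr 1
        ring
    _ ≤ 2 ^ N := Nat.pow_le_pow_right (by norm_num) (by rw [pow_add] at h; omega)

/-- With q = 2^N, the answer lists contribute at most q^(3/2) and K^4 at most q^(1/2); against q ·
q^(-4) this leaves 1/q. -/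
theorem answers_mul_discrepancy_le {m N K : ℕ} (hm : 0 < m) (h : (2 * m) ^ 3 ≤ N ^ 2)
    (hK : 2 ^ (K + 2) ≤ N) :
    (8 * (m : ℝ) ^ 2) ^ m * (2 ^ N * ((K : ℝ) / 2 ^ N) ^ 4) ≤ 1 / 2 ^ N := by
  have h1 : (8 * (m : ℝ) ^ 2) ^ m * (K : ℝ) ^ 4 ≤ (2 ^ N) ^ 2 := by
    refine (pow_le_pow_iff_left₀ (by positivity) (by positivity) two_ne_zero).1 ?_
    have h2 : (K : ℝ) ^ 8 ≤ 2 ^ N := by exact_mod_cast pow_eight_le hK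
    calc ((8 * (m : ℝ) ^ 2) ^ m * (K : ℝ) ^ 4) ^ 2 = ((8 * (m : ℝ) ^ 2) ^ m) ^ 2 * (K : ℝ) ^ 8 := by
          ring
      _ ≤ 2 ^ (3 * N) * 2 ^ N := mul_le_mul (answers_sq_le hm h) h2 (by positivity) (by positivity)
      _ = ((2 ^ N) ^ 2) ^ 2 := by ring
  have hq : (0 : ℝ) < 2 ^ N := by positivity
  calc _ = (8 * (m : ℝ) ^ 2) ^ m * (K : ℝ) ^ 4 / (2 ^ N) ^ 3 := by field_simp
    _ ≤ (2 ^ N) ^ 2 / (2 ^ N) ^ 3 := by gcongr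
    _ = 1 / 2 ^ N := by field_simp

theorem two_pow_mul_lt {m N L C : ℕ} {δ : ℝ} (hN : 4 ≤ N) (hmN : 2 * m ≤ N)
    (hL : (L : ℝ) < 1 / 100 * √((2 * m : ℕ) : ℝ)) (hC : (C : ℝ) < N / 50)
    (hδ : δ ≤ 2 / 3) (hδ' : δ ≤ 2 * Real.exp (-(√m / 3))) :
    2 ^ L * (δ + 2 ^ C * (1 / 2 ^ N)) < 3 / 4 := by
  have hC' : 50 * C < N := by
    have : (50 * C : ℝ) < N := by linarith
    exact_mod_cast this
  have hL' : L ≤ L ^ 2 := Nat.le_self_pow two_ne_zero L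
  have hL2 : 10000 * L ^ 2 ≤ N := by
    have h1 : (100 * (L : ℝ)) ^ 2 ≤ (2 * m : ℕ) := by
      rw [← Real.sq_sqrt (Nat.cast_nonneg (2 * m))]
      exact pow_le_pow_left₀ (by positivity) (by linarith) 2
    have h2 : (10000 * (L : ℝ) ^ 2) ≤ (2 * m : ℕ) := by linarith
    have h3 : 10000 * L ^ 2 ≤ 2 * m := by exact_mod_cast h2
    omega
  -- L and C are at most N/10000 and N/50, so L + C + 4 ≤ N; when N = 4 both are 0 and equality
  -- holds.
  have hsmall : (2 : ℝ) ^ L * (2 ^ C * (1 / 2 ^ N)) ≤ 1 / 16 := by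
    have h1 : (2 : ℝ) ^ (L + C + 4) ≤ 2 ^ N := pow_le_pow_right₀ (by norm_num) (by omega)
    rw [pow_add, pow_add] at h1
    rw [mul_one_div, ← mul_div_assoc, div_le_div_iff₀ (by positivity) (by norm_num)]
    linarith
  rw [mul_add]
  -- For L = 0 nothing forces m to be large and the exponential bound may be useless, but 2/3 + 1/16
  -- < 3/4. For L ≥ 1 the hypothesis gives √m ≥ 60 L, and the exponential bound absorbs 2^L.
  rcases Nat.eq_zero_or_pos L with rfl | hL0
  · rw [pow_zero, one_mul] at *
    linarith
  · have hL1 : (1 : ℝ) ≤ L := by exact_mod_cast hL0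
    have hm : 60 * (L : ℝ) ≤ √m := by
      rw [Nat.cast_mul, Nat.cast_ofNat, Real.sqrt_mul (by norm_num)] at hL
      have h2 : √(2 : ℝ) ≤ 3 / 2 := by
        rw [Real.sqrt_le_left (by norm_num)]
        norm_num
      have h3 : √(2 : ℝ) * √m ≤ 3 / 2 * √m := by gcongr
      linarith
    have h1 : (2 : ℝ) ^ L ≤ Real.exp L := by
      rw [← Real.exp_one_pow]
      refine pow_le_pow_left₀ (by norm_num) ?_ L
      linarith [Real.add_one_le_exp 1]
    have h2 : (2 : ℝ) ^ L * δ ≤ 1 / 4 := by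
      calc (2 : ℝ) ^ L * δ ≤ 2 ^ L * (2 * Real.exp (-(√m / 3))) := by gcongr
        _ ≤ Real.exp L * (2 * Real.exp (-(20 * L))) := by
            gcongr
            linarith
        _ = 2 * Real.exp (-(19 * L)) := by
            rw [mul_left_comm, ← Real.exp_add]
            congr 2
            ring
        _ ≤ 2 * Real.exp (-19) := by
            gcongr
            linarith
        _ ≤ 1 / 4 := by
            rw [Real.exp_neg, ← div_eq_mul_inv, div_le_div_iff₀ (Real.exp_pos _) (by norm_num)]
            linarith [Real.add_one_le_exp 19]
    linarith

end NOF

/-! ### Choice of the constants -/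

theorem mainTheorem2 :
    ∃ c : ℝ, 0 < c ∧
      ∀ (k n : ℕ), 2 ≤ k → (k : ℝ) ≤ Real.logb 2 n / 2 →
      ∀ (F : Type) [Field F] (e : F ≃ NOF.BitString (NOF.fieldBits k n))
        (Q : NOF.Protocol k (Fin (NOF.numMatchings k n)) (NOF.BitString n)
          (Fin (NOF.gadgetBits k n) × Fin (NOF.gadgetBits k n) × Bool)),
        Q.IsSimplified →
        Q.error (NOF.liftedHM (NOF.gadget e)) ≤ 1 / 16 →
          c * Real.sqrt (NOF.gadgetBits k n) ≤ Q.len₁ ∨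
          c * ((n : ℝ) / 2 ^ k) ≤ ((∑ i, Q.len i : ℕ) : ℝ) := by
  refine ⟨1 / 100, by norm_num, ?_⟩
  rintro k n hk hkn F _ e _ ⟨P, rfl⟩ herr
  classical
  rcases Nat.eq_zero_or_pos (NOF.numMatchings k n) with hm | hm
  · left
    simp [NOF.gadgetBits, hm]
  have : NeZero (NOF.numMatchings k n) := ⟨hm.ne'⟩
  let _ : Fintype F := Fintype.ofEquiv _ e.symm
  have hq : Fintype.card F = 2 ^ NOF.fieldBits k n := by
    rw [Fintype.card_congr e]
    simp
  have hN := NOF.two_pow_le_fieldBits hk hkn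
  have hN4 : 4 ≤ NOF.fieldBits k n :=
    (Nat.pow_le_pow_right (by norm_num) hk : 2 ^ 2 ≤ 2 ^ k).trans hN
  by_contra hcon
  push Not at hcon
  obtain ⟨hL, hC⟩ := hcon
  have hC' : ((∑ i, P.simplify.len i : ℕ) : ℝ) < NOF.fieldBits k n / 50 := by
    have h1 : (n : ℝ) / 2 ^ k ≤ NOF.fieldBits k n + 1 := by
      rw [div_le_iff₀ (by positivity)]
      have h2 := (Nat.lt_mul_div_succ n (by positivity : 0 < 2 ^ k)).le
      rw [mul_comm] at h2
      exact_mod_cast h2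
    have h3 : (4 : ℝ) ≤ NOF.fieldBits k n := by exact_mod_cast hN4
    linarith
  have hkey : ∀ δ : ℝ, (∀ l : Fin (NOF.numMatchings k n) →
      Fin (NOF.gadgetBits k n) × Fin (NOF.gadgetBits k n) × Bool,
      (Finset.univ.expect fun z => (if 3 * NOF.numMatchings k n ≤ 4 * NOF.hits l z then (1 : ℝ)
        else 0)) ≤ δ) →
      3 / 4 ≤ 2 ^ P.simplify.len₁ *
        (δ + 2 ^ (∑ i, P.simplify.len i) * (1 / 2 ^ NOF.fieldBits k n)) := fun δ hδ => by
    have hk2 : k = (k - 2) + 2 := by omega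
    -- The exponent 4 in ε comes from 2^k = 4 · 2^(k-2): there are 2^k blocks, and k - 2
    -- Cauchy–Schwarz steps cost a root of order 2^(k-2).
    refine (NOF.three_quarters_le_of_error_le hk e P herr
      (ε := (((k - 2 : ℕ) : ℝ) / Fintype.card F) ^ 4) (by positivity) (le_of_eq ?_) hδ).trans ?_
    · rw [← pow_mul]
      congr 1
      nth_rewrite 1 [hk2]
      rw [pow_add]
      ring
    · rw [mul_assoc (2 ^ _), hq]
      push_cast
      gcongr
      exact NOF.answers_mul_discrepancy_le hm (NOF.gadgetBits_pow_three_le k n) (hk2 ▸ hN)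
  have hmin := hkey (min (2 / 3) (2 * Real.exp (-(√(NOF.numMatchings k n : ℝ) / 3))))
    fun l => le_min (NOF.expect_many_hits_le_two_thirds l) (NOF.expect_many_hits_le_exp l)
  exact absurd hmin (not_le.2 (NOF.two_pow_mul_lt hN4 (NOF.gadgetBits_le k n) hL hC'
    (min_le_left _ _) (min_le_right _ _)))
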